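/- A partition is a weakly decreasing sequence $\lambda=(\lambda_1,\lambda_2,\dots,\lambda_\ell)$ of $\ell\ge 0$ positive integers, its parts, with the convention $\lambda_k=0$ for $k>\ell$. Let $\mathcal D_4$ be the set of all partitions (of all sizes, the empty partition included) in which each part size appears fewer than $4$ times, and for $\lambda\in\mathcal D_4$ let $e(\lambda)$ be the number of part sizes that appear exactly $2$ or $3$ times in $\lambda$. An overpartition is a partition in which the first occurrence of each part size may or may not be overlined; let $\overline{\mathcal P}$ be the set of all overpartitions (the empty one included), and for $\mu\in\overline{\mathcal P}$ let $|\mu|$ be the sum of all its parts, $\ell(\mu)$ the number of all its parts, and $o(\mu)$ the number of its overlined parts. Then, for every commutative ring $R$, both of the following sums converge in the ring of formal power series $R[[t_1,t_2,q]]$ (each monomial occurs only finitely often), and \[ \sum_{\lambda\in\mathcal D_4} t_1^{e(\lambda)}\,t_2^{\lambda_1-\lambda_2+\lambda_3-\lambda_4+\cdots}\,q^{\lambda_1+\lambda_3+\lambda_5+\cdots} =\sum_{\mu\in\overline{\mathcal P}} t_1^{o(\mu)}\,t_2^{\ell(\mu)-o(\mu)}\,q^{|\mu|}. \] -/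

import Mathlib

open scoped MvPowerSeries.WithPiTopology

/-- A partition of an arbitrary nonnegative integer (the empty partition is included). -/
abbrev AnyPartition : Type := Σ n : ℕ, n.Partition

namespace AnyPartition

/-- The parts of the partition, listed in weakly decreasing order. -/
def sortedParts (p : AnyPartition) : List ℕ := p.2.parts.sort (· ≥ ·)

/-- The `i`-th largest part, counted from `i = 0`, and `0` beyond the last part:
in the usual indexing from one this is `λ_{i+1}`. -/
def part (p : AnyPartition) (i : ℕ) : ℕ := p.sortedParts.getD i 0

/-- The number of parts. -/
def length (p : AnyPartition) : ℕ := p.2.parts.card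

/-- The size, that is the sum of all parts. -/
def size (p : AnyPartition) : ℕ := p.2.parts.sum

/-- The Schmidt weight `λ₁ + λ₃ + λ₅ + ⋯`. -/
def schmidtWeight (p : AnyPartition) : ℕ := ∑ k ∈ Finset.range p.length, p.part (2 * k)

/-- The alternating sum `(λ₁ - λ₂) + (λ₃ - λ₄) + ⋯`. The parts decrease weakly, so
no subtraction is truncated; see `coe_alternatingSum`. -/
def alternatingSum (p : AnyPartition) : ℕ :=
  ∑ k ∈ Finset.range p.length, (p.part (2 * k) - p.part (2 * k + 1))

/-- The number of part sizes that appear exactly two or three times. -/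
def repeatedSizes (p : AnyPartition) : ℕ :=
  (p.2.parts.toFinset.filter fun i => p.2.parts.count i = 2 ∨ p.2.parts.count i = 3).card

theorem length_sortedParts (p : AnyPartition) : p.sortedParts.length = p.length := by
  simp [sortedParts, length]

theorem part_antitone (p : AnyPartition) : Antitone p.part := by
  refine antitone_nat_of_succ_le fun i => ?_
  unfold part
  have hs : p.sortedParts.Pairwise (· ≥ ·) := Multiset.pairwise_sort _ _
  by_cases h : i + 1 < p.sortedParts.length
  · rw [List.getD_eq_getElem _ _ h, List.getD_eq_getElem _ _ (Nat.lt_of_succ_lt h)]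
    exact List.pairwise_iff_getElem.mp hs i (i + 1) _ h (Nat.lt_succ_self i)
  · rw [List.getD_eq_default _ _ (not_lt.mp h)]
    exact Nat.zero_le _

/-- The alternating sum, computed in the integers. -/
theorem coe_alternatingSum (p : AnyPartition) :
    (p.alternatingSum : ℤ) = ∑ i ∈ Finset.range p.length, (-1) ^ i * (p.part i : ℤ) := by
  have h1 : ∀ n : ℕ, ((∑ k ∈ Finset.range n, (p.part (2 * k) - p.part (2 * k + 1)) : ℕ) : ℤ)
      = ∑ i ∈ Finset.range (2 * n), (-1) ^ i * (p.part i : ℤ) := by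
    intro n
    induction n with
    | zero => simp
    | succ n ih =>
      have h := p.part_antitone (Nat.le_succ (2 * n))
      rw [Finset.sum_range_succ, Nat.cast_add, ih, Nat.cast_sub h, Nat.mul_succ,
        Finset.sum_range_succ, Finset.sum_range_succ]
      simp [pow_succ, pow_mul]
      ring
  unfold alternatingSum
  rw [h1]
  symm
  refine Finset.sum_subset (Finset.range_mono (by omega)) fun i _ hi => ?_
  have : p.part i = 0 := by
    unfold part
    refine List.getD_eq_default _ _ ?_
    rw [length_sortedParts]
    simpa using hi
  simp [this]

end AnyPartition

/-- The partitions (of all sizes) in which each part size appears fewer than `m` times. -/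
abbrev PartitionsRepeatedLT (m : ℕ) : Type :=
  {p : AnyPartition // p.2 ∈ Nat.Partition.countRestricted p.1 m}

/-- An overpartition: a partition in which the first occurrence of each part size may be
overlined. It is recorded by the set of those part sizes whose first occurrence is overlined. -/
@[ext]
structure Overpartition where
  toPartition : AnyPartition
  overlined : Finset ℕ
  overlined_subset : overlined ⊆ toPartition.2.parts.toFinset

namespace Overpartition

/-- The number of overlined parts. -/
def numOverlined (μ : Overpartition) : ℕ := μ.overlined.card

/-- The number of parts, overlined or not. -/
def length (μ : Overpartition) : ℕ := μ.toPartition.length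

/-- The sum of all parts, overlined or not. -/
def size (μ : Overpartition) : ℕ := μ.toPartition.size

/-- There are at most as many overlined parts as parts, so that the difference
`ℓ(μ) - o(μ)` of natural numbers is never truncated. -/
theorem numOverlined_le_length (μ : Overpartition) : μ.numOverlined ≤ μ.length :=
  (Finset.card_le_card μ.overlined_subset).trans (Multiset.toFinset_card_le _)

end Overpartition

/-! A partition in which no size appears four times is uniquely A + 2B, with A and B finite sets of
sizes. Two equal parts occupy neighbouring positions, so the copies from 2B leave the alternating
sum alone, add |B| to the Schmidt weight, and account for the sizes appearing 2 or 3 times. The left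
side is thus a product of a sum over A and a sum over B. An overpartition is a set of overlined
parts plus a multiset M of the others, so the right side factors too, and the set factors agree.

What remains is the refined Schmidt theorem `tsum_distinct_eq_tsum`, relating distinct A to
multisets M. Multiply both sides by the generating function of all partitions, a unit. On the left,
A + 2N with N any multiset runs over all partitions, counted by alternating sum and Schmidt weight.
On the right, pairs (M, N) correspond to partitions by `conjugateHalves`: the conjugate has λᵢ -
λᵢ₊₁ parts equal to i, and its odd and even parts give M and N. -/

namespace List

/-- The sums of the entries of a list at even and at odd positions, counted from `0`. -/
def alternateSums (l : List ℕ) : ℕ × ℕ := l.foldr (fun a x => (a + x.2, x.1)) (0, 0)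

@[simp] theorem alternateSums_nil : alternateSums [] = (0, 0) := rfl

@[simp] theorem alternateSums_cons (a : ℕ) (l : List ℕ) :
    alternateSums (a :: l) = (a + (alternateSums l).2, (alternateSums l).1) := rfl

/-- The two copies land side by side, one at each parity, and every later entry shifts by two
places. -/
theorem alternateSums_orderedInsert_pair (a : ℕ) (l : List ℕ) :
    alternateSums ((l.orderedInsert (· ≥ ·) a).orderedInsert (· ≥ ·) a) =
      ((alternateSums l).1 + a, (alternateSums l).2 + a) := by
  induction l with
  | nil => simp
  | cons b l ih =>
    by_cases h : a ≥ b
    · simp [orderedInsert, h]; omega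
    · simp only [orderedInsert, h, if_false, alternateSums_cons, ih, Prod.mk.injEq, and_true]
      omega

theorem sum_getD_two_mul (l : List ℕ) (n : ℕ) (h : l.length ≤ n) :
    ∑ k ∈ Finset.range n, l.getD (2 * k) 0 = (alternateSums l).1 ∧
    ∑ k ∈ Finset.range n, l.getD (2 * k + 1) 0 = (alternateSums l).2 := by
  induction l generalizing n with
  | nil => simp
  | cons a l ih =>
    rw [length_cons] at h
    refine ⟨?_, ?_⟩
    · obtain ⟨n, rfl⟩ : ∃ m, n = m + 1 := ⟨n - 1, by omega⟩
      -- Past the head, even positions of `a :: l` are odd positions of `l`.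
      rw [Finset.sum_range_succ', alternateSums_cons, ← (ih n (by omega)).2]
      exact add_comm _ _
    · rw [alternateSums_cons, ← (ih n (by omega)).1]
      simp

end List

/-! ### Partitions as multisets of positive integers; adding doubled parts -/

namespace AnyPartition

theorem schmidtWeight_eq_alternateSums (p : AnyPartition) :
    p.schmidtWeight = p.sortedParts.alternateSums.1 :=
  (List.sum_getD_two_mul _ _ p.length_sortedParts.le).1

theorem alternatingSum_eq_alternateSums (p : AnyPartition) :
    p.alternatingSum = p.sortedParts.alternateSums.1 - p.sortedParts.alternateSums.2 := by
  obtain ⟨h1, h2⟩ := List.sum_getD_two_mul _ _ p.length_sortedParts.le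
  rw [← h1, ← h2]
  exact Finset.sum_tsub_distrib _ fun k _ => p.part_antitone (Nat.le_succ (2 * k))

theorem part_eq_zero_iff (p : AnyPartition) (i : ℕ) : p.part i = 0 ↔ p.length ≤ i := by
  rw [← length_sortedParts]
  refine ⟨fun h => ?_, fun h => List.getD_eq_default _ _ h⟩
  by_contra! hi
  rw [part, List.getD_eq_getElem _ _ hi] at h
  have := p.2.parts_pos ((Multiset.mem_sort (· ≥ ·)).1 (List.getElem_mem hi))
  omega

theorem ext_parts {p p' : AnyPartition} (h : p.2.parts = p'.2.parts) : p = p' := by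
  obtain ⟨n, p⟩ := p
  obtain ⟨n', p'⟩ := p'
  obtain rfl : n = n' := by rw [← p.parts_sum, ← p'.parts_sum]; exact congrArg _ h
  exact congrArg _ (Nat.Partition.ext h)

theorem part_injective : Function.Injective part := by
  intro p p' h
  have hl : p.length = p'.length := by
    apply le_antisymm
    · rw [← part_eq_zero_iff, h, part_eq_zero_iff]
    · rw [← part_eq_zero_iff, ← h, part_eq_zero_iff]
  have hs : p.sortedParts = p'.sortedParts := by
    refine List.ext_getElem (by simp [length_sortedParts, hl]) fun i hi hi' => ?_
    have := congrFun h i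
    rwa [part, part, List.getD_eq_getElem _ _ hi, List.getD_eq_getElem _ _ hi'] at this
  apply ext_parts
  rw [← Multiset.sort_eq p.2.parts (· ≥ ·), ← Multiset.sort_eq p'.2.parts (· ≥ ·)]
  exact congrArg _ hs

/-- The partition with a given multiset of positive parts. -/
def ofParts (s : Multiset ℕ+) : AnyPartition :=
  ⟨(s.map PNat.val).sum, ⟨s.map PNat.val, by
    intro i hi
    obtain ⟨a, -, rfl⟩ := Multiset.mem_map.1 hi
    exact a.pos, rfl⟩⟩

@[simp] theorem ofParts_parts (s : Multiset ℕ+) :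
    (ofParts s).2.parts = s.map PNat.val := rfl

theorem ofParts_bijective : Function.Bijective ofParts := by
  refine ⟨fun s s' h => ?_, fun p => ?_⟩
  · have : (ofParts s).2.parts = (ofParts s').2.parts := by rw [h]
    exact Multiset.map_injective PNat.coe_injective this
  · have key : ∀ s : Multiset ℕ, (∀ i ∈ s, 0 < i) →
        ∃ s' : Multiset ℕ+, s'.map PNat.val = s := by
      intro s
      induction s using Multiset.induction_on with
      | empty => exact fun _ => ⟨0, rfl⟩
      | cons a s ih =>
        intro h
        obtain ⟨s', rfl⟩ := ih fun i hi => h i (Multiset.mem_cons_of_mem hi)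
        exact ⟨(⟨a, h a (Multiset.mem_cons_self _ _)⟩ : ℕ+) ::ₘ s', Multiset.map_cons _ _ _⟩
    obtain ⟨s, hs⟩ := key p.2.parts fun i hi => p.2.parts_pos hi
    exact ⟨s, ext_parts hs⟩

theorem length_ofParts (s : Multiset ℕ+) : (ofParts s).length = s.card := by
  simp [length]

theorem size_ofParts (s : Multiset ℕ+) :
    (ofParts s).size = (s.map PNat.val).sum := rfl

theorem sortedParts_ofParts_cons (a : ℕ+) (s : Multiset ℕ+) :
    (ofParts (a ::ₘ s)).sortedParts =
      (ofParts s).sortedParts.orderedInsert (· ≥ ·) (a : ℕ) := by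
  refine List.Perm.eq_of_pairwise' (r := (· ≥ ·)) (Multiset.pairwise_sort _ _)
    ((Multiset.pairwise_sort _ _).orderedInsert _ _) ?_
  refine List.Perm.trans ?_ (List.perm_orderedInsert _ _ _).symm
  rw [← Multiset.coe_eq_coe, ← Multiset.cons_coe]
  simp [sortedParts]

theorem alternateSums_ofParts_add (s t : Multiset ℕ+) :
    (ofParts (s + 2 • t)).sortedParts.alternateSums =
      ((ofParts s).sortedParts.alternateSums.1 + (ofParts t).size,
        (ofParts s).sortedParts.alternateSums.2 + (ofParts t).size) := by
  induction t using Multiset.induction_on with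
  | empty => simp [size_ofParts]
  | cons a t ih =>
    have : s + 2 • (a ::ₘ t) = a ::ₘ a ::ₘ (s + 2 • t) := by
      simp [two_nsmul]
    rw [this, sortedParts_ofParts_cons, sortedParts_ofParts_cons,
      List.alternateSums_orderedInsert_pair, ih]
    simp [size_ofParts]
    omega

theorem schmidtWeight_ofParts_add (s t : Multiset ℕ+) :
    (ofParts (s + 2 • t)).schmidtWeight = (ofParts s).schmidtWeight + (ofParts t).size := by
  simp only [schmidtWeight_eq_alternateSums, alternateSums_ofParts_add]

theorem alternatingSum_ofParts_add (s t : Multiset ℕ+) :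
    (ofParts (s + 2 • t)).alternatingSum = (ofParts s).alternatingSum := by
  simp only [alternatingSum_eq_alternateSums, alternateSums_ofParts_add]
  omega

/-- The multiplicity of a size is [a ∈ A] + 2[a ∈ B], which is 2 or 3 exactly when a ∈ B. -/
theorem repeatedSizes_ofParts_add (A B : Finset ℕ+) :
    (ofParts (A.val + 2 • B.val)).repeatedSizes = B.card := by
  rw [repeatedSizes, ← Finset.card_map ⟨PNat.val, PNat.coe_injective⟩]
  congr 1
  ext i
  rw [Finset.mem_filter, Multiset.mem_toFinset, ofParts_parts]
  simp only [Multiset.mem_map, Finset.mem_map, Function.Embedding.coeFn_mk]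
  have hA := fun a => Multiset.nodup_iff_count_le_one.1 A.nodup a
  have hB := fun a => Multiset.nodup_iff_count_le_one.1 B.nodup a
  have hc : ∀ a : ℕ+, ((A.val + 2 • B.val).map PNat.val).count (a : ℕ) =
      A.val.count a + 2 * B.val.count a := fun a => by
    rw [Multiset.count_map_eq_count' _ _ PNat.coe_injective]; simp
  constructor
  · rintro ⟨⟨a, -, rfl⟩, h⟩
    rw [hc] at h
    refine ⟨a, ?_, rfl⟩
    rw [← Finset.mem_val, ← Multiset.count_pos]
    have := hA a
    omega
  · rintro ⟨a, ha, rfl⟩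
    have h1 : 0 < B.val.count a := Multiset.count_pos.2 ha
    have h2 := hA a
    have h3 := hB a
    refine ⟨⟨a, ?_, rfl⟩, ?_⟩
    · rw [← Multiset.count_pos, Multiset.count_add, Multiset.count_nsmul]; omega
    · rw [hc]; omega

end AnyPartition

/-! ### Splitting multiplicities into remainder and quotient by 2 -/

namespace Multiset

variable {α : Type*} [DecidableEq α]

theorem exists_count_eq (f : α → ℕ) (s : Multiset α) (h : ∀ a, f a ≤ s.count a) :
    ∃ t : Multiset α, ∀ a, t.count a = f a := by
  have hf : (Function.support f).Finite := s.toFinset.finite_toSet.subset fun a ha => by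
    have : f a ≠ 0 := ha
    have := h a
    simpa using Multiset.count_pos.1 (by omega)
  exact ⟨Finsupp.toMultiset (Finsupp.ofSupportFinite f hf), fun a => by
    rw [Finsupp.count_toMultiset]; rfl⟩

/-- Every multiset is uniquely a set plus twice a multiset. -/
theorem finset_add_two_nsmul_bijective :
    Function.Bijective (fun x : Finset α × Multiset α => x.1.val + 2 • x.2) := by
  constructor
  · rintro ⟨A, B⟩ ⟨A', B'⟩ h
    have hA := fun a => Multiset.nodup_iff_count_le_one.1 A.nodup a
    have hA' := fun a => Multiset.nodup_iff_count_le_one.1 A'.nodup a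
    have hc : ∀ a, A.val.count a + 2 * B.count a = A'.val.count a + 2 * B'.count a := fun a => by
      simpa using congrArg (count a) h
    refine Prod.ext (Finset.val_injective (Multiset.ext.2 fun a => ?_)) (Multiset.ext.2 fun a => ?_)
    all_goals
      have := hc a
      have := hA a
      have := hA' a
      dsimp only
      omega
  · intro s
    obtain ⟨A, hA⟩ := exists_count_eq (fun a => s.count a % 2) s fun a => Nat.mod_le _ _
    obtain ⟨B, hB⟩ := exists_count_eq (fun a => s.count a / 2) s fun a => Nat.div_le_self _ _
    have hn : A.Nodup := Multiset.nodup_iff_count_le_one.2 fun a => by rw [hA]; omega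
    refine ⟨(⟨A, hn⟩, B), Multiset.ext.2 fun a => ?_⟩
    simp only [count_add, count_nsmul, hA, hB]
    omega

end Multiset

/-- The partition in which the sizes from `x.2` are repeated twice and those from `x.1` are
then added once. -/
def PartitionsRepeatedLT.ofFinsets (x : Finset ℕ+ × Finset ℕ+) : PartitionsRepeatedLT 4 :=
  ⟨AnyPartition.ofParts (x.1.val + 2 • x.2.val), by
    refine Finset.mem_filter.2 ⟨Finset.mem_univ _, fun i hi => ?_⟩
    obtain ⟨a, -, rfl⟩ := Multiset.mem_map.1 hi
    rw [AnyPartition.ofParts_parts, Multiset.count_map_eq_count' _ _ PNat.coe_injective]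
    have hA := Multiset.nodup_iff_count_le_one.1 x.1.nodup a
    have hB := Multiset.nodup_iff_count_le_one.1 x.2.nodup a
    simp only [Multiset.count_add, Multiset.count_nsmul]
    omega⟩

theorem PartitionsRepeatedLT.ofFinsets_bijective :
    Function.Bijective PartitionsRepeatedLT.ofFinsets := by
  constructor
  · rintro ⟨A, B⟩ ⟨A', B'⟩ h
    have h1 := AnyPartition.ofParts_bijective.1 (congrArg Subtype.val h)
    have h2 := Multiset.finset_add_two_nsmul_bijective.1 (a₁ := (A, B.val)) (a₂ := (A', B'.val)) h1
    simpa using h2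
  · rintro ⟨p, hp⟩
    obtain ⟨s, rfl⟩ := AnyPartition.ofParts_bijective.2 p
    obtain ⟨⟨A, B⟩, rfl⟩ := Multiset.finset_add_two_nsmul_bijective.2 s
    have hn : B.Nodup := Multiset.nodup_iff_count_le_one.2 fun a => by
      by_contra! h
      have hc : 4 ≤ (A.val + 2 • B).count a := by
        simp only [Multiset.count_add, Multiset.count_nsmul]; omega
      have := (Finset.mem_filter.1 hp).2 a
        (Multiset.mem_map_of_mem _ (Multiset.count_pos.1 (by dsimp only; omega)))
      rw [AnyPartition.ofParts_parts, Multiset.count_map_eq_count' _ _ PNat.coe_injective] at this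
      dsimp only at this
      omega
    exact ⟨(A, ⟨B, hn⟩), rfl⟩

/-! ### Overpartitions as a set plus a multiset -/

namespace Overpartition

/-- The overpartition with a given set of overlined parts and multiset of other parts. -/
def ofParts (x : Finset ℕ+ × Multiset ℕ+) : Overpartition where
  toPartition := AnyPartition.ofParts (x.1.val + x.2)
  overlined := x.1.map ⟨PNat.val, PNat.coe_injective⟩
  overlined_subset i hi := by
    obtain ⟨a, ha, rfl⟩ := Finset.mem_map.1 hi
    rw [Multiset.mem_toFinset]
    exact Multiset.mem_map_of_mem _ (Multiset.mem_add.2 (Or.inl ha))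

theorem ofParts_bijective : Function.Bijective ofParts := by
  constructor
  · rintro ⟨A, B⟩ ⟨A', B'⟩ h
    obtain rfl : A = A' := Finset.map_injective _ (congrArg overlined h)
    have h2 := AnyPartition.ofParts_bijective.1 (congrArg toPartition h)
    simpa using h2
  · rintro ⟨p, O, h⟩
    obtain ⟨s, rfl⟩ := AnyPartition.ofParts_bijective.2 p
    obtain ⟨A, hA, rfl⟩ : ∃ A : Finset ℕ+, A ⊆ s.toFinset ∧ O = A.map ⟨PNat.val, PNat.coe_injective⟩ := by
      refine ⟨s.toFinset.filter fun a => (a : ℕ) ∈ O, Finset.filter_subset _ _, ?_⟩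
      ext i
      simp only [Finset.mem_map, Finset.mem_filter, Function.Embedding.coeFn_mk]
      constructor
      · intro hi
        obtain ⟨a, ha, rfl⟩ := Multiset.mem_map.1 (Multiset.mem_toFinset.1 (h hi))
        exact ⟨a, ⟨Multiset.mem_toFinset.2 ha, hi⟩, rfl⟩
      · rintro ⟨a, ⟨-, hi⟩, rfl⟩
        exact hi
    have hle : A.val ≤ s := (Multiset.le_iff_subset A.nodup).2 fun a ha =>
      Multiset.mem_toFinset.1 (hA ha)
    refine ⟨(A, s - A.val), Overpartition.ext ?_ rfl⟩
    exact congrArg AnyPartition.ofParts (add_tsub_cancel_of_le hle)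

theorem numOverlined_ofParts (x : Finset ℕ+ × Multiset ℕ+) :
    (ofParts x).numOverlined = x.1.card := Finset.card_map _

theorem length_ofParts (x : Finset ℕ+ × Multiset ℕ+) :
    (ofParts x).length = x.1.card + x.2.card := by
  refine (AnyPartition.length_ofParts _).trans ?_
  simp

theorem size_ofParts (x : Finset ℕ+ × Multiset ℕ+) :
    (ofParts x).size = (AnyPartition.ofParts x.1.val).size + (AnyPartition.ofParts x.2).size := by
  refine (AnyPartition.size_ofParts _).trans ?_
  simp [AnyPartition.size_ofParts]

end Overpartition

/-! ### Conjugation, split by the parity of the parts -/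

/-- The multiset in which `k + 1` appears `f k` times, for `k < n`. -/
def Multiset.ofMultiplicities (n : ℕ) (f : ℕ → ℕ) : Multiset ℕ+ :=
  ∑ k ∈ Finset.range n, Multiset.replicate (f k) k.succPNat

theorem Multiset.count_ofMultiplicities {n : ℕ} {f : ℕ → ℕ} (hf : ∀ k, n ≤ k → f k = 0)
    (k : ℕ) : (ofMultiplicities n f).count k.succPNat = f k := by
  have h : ∀ i : ℕ, i.succPNat = k.succPNat ↔ i = k := fun i => Nat.succPNat_inj
  simp only [ofMultiplicities, Multiset.count_sum', Multiset.count_replicate, h,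
    Finset.sum_ite_eq', Finset.mem_range]
  split_ifs with hk
  · rfl
  · exact (hf k (not_lt.1 hk)).symm

theorem Multiset.card_ofMultiplicities (n : ℕ) (f : ℕ → ℕ) :
    (ofMultiplicities n f).card = ∑ k ∈ Finset.range n, f k := by
  simp [ofMultiplicities]

theorem AnyPartition.size_ofParts_ofMultiplicities (n : ℕ) (f : ℕ → ℕ) :
    (ofParts (Multiset.ofMultiplicities n f)).size = ∑ k ∈ Finset.range n, (k + 1) * f k := by
  induction n with
  | zero => rfl
  | succ n ih =>
    rw [Finset.sum_range_succ, ← ih]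
    simp [size_ofParts, Multiset.ofMultiplicities, Finset.sum_range_succ, mul_comm]

/-- Abel summation; monotonicity keeps the subtractions from truncating. -/
theorem Finset.sum_range_succ_mul_sub {a : ℕ → ℕ} (ha : Antitone a) (n : ℕ) :
    ∑ k ∈ range n, (k + 1) * (a k - a (k + 1)) + n * a n = ∑ k ∈ range n, a k := by
  induction n with
  | zero => simp
  | succ n ih =>
    obtain ⟨c, hc⟩ := Nat.exists_eq_add_of_le (ha (Nat.le_succ n))
    rw [sum_range_succ, sum_range_succ, ← ih, hc, Nat.succ_eq_add_one]
    simp only [add_tsub_cancel_left]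
    ring

namespace AnyPartition

/-- The difference of consecutive parts. -/
def partDiff (p : AnyPartition) (i : ℕ) : ℕ := p.part i - p.part (i + 1)

theorem partDiff_eq_zero (p : AnyPartition) {i : ℕ} (h : p.length ≤ i) : p.partDiff i = 0 := by
  rw [partDiff, (p.part_eq_zero_iff i).2 h, zero_tsub]

/-- Half the odd parts (rounded up), and half the even parts, of the conjugate partition. -/
def conjugateHalves (p : AnyPartition) : Multiset ℕ+ × Multiset ℕ+ :=
  (.ofMultiplicities p.length fun k => p.partDiff (2 * k),
    .ofMultiplicities p.length fun k => p.partDiff (2 * k + 1))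

theorem card_conjugateHalves_fst (p : AnyPartition) :
    p.conjugateHalves.1.card = p.alternatingSum := Multiset.card_ofMultiplicities _ _

/-- The two multiplicities of k + 1 add up to the drop between consecutive odd-indexed parts λ₂ₖ₊₁
and λ₂ₖ₊₃, so Abel summation applies. -/
theorem size_conjugateHalves (p : AnyPartition) :
    (ofParts p.conjugateHalves.1).size + (ofParts p.conjugateHalves.2).size =
      p.schmidtWeight := by
  have ha : Antitone fun k => p.part (2 * k) := fun i j h => p.part_antitone (by omega)
  have h := Finset.sum_range_succ_mul_sub ha p.length
  rw [(p.part_eq_zero_iff (2 * p.length)).2 (by omega), mul_zero, add_zero] at h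
  rw [schmidtWeight, ← h, conjugateHalves, size_ofParts_ofMultiplicities,
    size_ofParts_ofMultiplicities, ← Finset.sum_add_distrib]
  refine Finset.sum_congr rfl fun k _ => ?_
  have h1 := p.part_antitone (Nat.le_succ (2 * k))
  have h2 := p.part_antitone (Nat.le_succ (2 * k + 1))
  rw [← mul_add]
  congr 1
  exact tsub_add_tsub_cancel h1 h2

theorem count_conjugateHalves_fst (p : AnyPartition) (k : ℕ) :
    p.conjugateHalves.1.count k.succPNat = p.partDiff (2 * k) :=
  Multiset.count_ofMultiplicities (f := fun k => p.partDiff (2 * k))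
    (fun _ h => p.partDiff_eq_zero (by omega)) k

theorem count_conjugateHalves_snd (p : AnyPartition) (k : ℕ) :
    p.conjugateHalves.2.count k.succPNat = p.partDiff (2 * k + 1) :=
  Multiset.count_ofMultiplicities (f := fun k => p.partDiff (2 * k + 1))
    (fun _ h => p.partDiff_eq_zero (by omega)) k

theorem part_eq_sum_partDiff (p : AnyPartition) {n i : ℕ} (hn : p.length ≤ n) (hi : i ≤ n) :
    p.part i = ∑ j ∈ Finset.Ico i n, p.partDiff j := by
  induction hi using Nat.decreasingInduction with
  | self => simpa using (p.part_eq_zero_iff n).2 hn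
  | of_succ i h ih =>
    rw [Finset.sum_eq_sum_Ico_succ_bot h, ← ih, partDiff]
    exact (Nat.sub_add_cancel (p.part_antitone (Nat.le_succ i))).symm

theorem partDiff_injective : Function.Injective partDiff := by
  intro p p' h
  refine part_injective (funext fun i => ?_)
  rw [p.part_eq_sum_partDiff (n := p.length + p'.length + i) (by omega) (by omega),
    p'.part_eq_sum_partDiff (n := p.length + p'.length + i) (by omega) (by omega), h]

theorem exists_part_eq {g : ℕ → ℕ} (hg : Antitone g) {N : ℕ} (hN : g N = 0) :
    ∃ p : AnyPartition, p.part = g := by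
  classical
  have hex : ∃ n, g n = 0 := ⟨N, hN⟩
  -- Stopping at the first zero of `g` keeps all listed parts positive.
  let l := (List.range (Nat.find hex)).map g
  have hsort : l.Pairwise (· ≥ ·) :=
    List.pairwise_map.2 (List.pairwise_lt_range.imp fun h => hg h.le)
  have hpos : ∀ {i}, i ∈ (l : Multiset ℕ) → 0 < i := by
    intro i hi
    obtain ⟨k, hk, rfl⟩ := List.mem_map.1 (Multiset.mem_coe.1 hi)
    exact Nat.pos_of_ne_zero (Nat.find_min hex (List.mem_range.1 hk))
  refine ⟨⟨_, ⟨(l : Multiset ℕ), hpos, rfl⟩⟩, funext fun i => ?_⟩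
  have hl : sortedParts ⟨_, ⟨(l : Multiset ℕ), hpos, rfl⟩⟩ = l :=
    List.Perm.eq_of_pairwise' (r := (· ≥ ·)) (Multiset.pairwise_sort _ _) hsort
      (Multiset.coe_eq_coe.1 (Multiset.sort_eq _ _))
  rw [part, hl]
  by_cases hi : i < Nat.find hex
  · rw [List.getD_eq_getElem _ _ (by simpa [l] using hi)]
    simp [l]
  · rw [List.getD_eq_default _ _ (by simpa [l] using not_lt.1 hi)]
    exact (Nat.le_zero.1 ((hg (not_lt.1 hi)).trans_eq (Nat.find_spec hex))).symm

theorem exists_partDiff_eq {d : ℕ → ℕ} {N : ℕ} (hd : ∀ i, N ≤ i → d i = 0) :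
    ∃ p : AnyPartition, p.partDiff = d := by
  obtain ⟨p, hp⟩ := exists_part_eq (g := fun i => ∑ j ∈ Finset.Ico i N, d j) (N := N)
    (fun i j h => Finset.sum_le_sum_of_subset (Finset.Ico_subset_Ico_left h)) (by simp)
  refine ⟨p, funext fun i => ?_⟩
  rw [partDiff, hp]
  by_cases hi : i < N
  · simp [Finset.sum_eq_sum_Ico_succ_bot hi]
  · dsimp only
    rw [hd i (not_lt.1 hi), Finset.Ico_eq_empty hi]
    simp

theorem conjugateHalves_bijective : Function.Bijective conjugateHalves := by
  constructor
  · intro p p' h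
    refine partDiff_injective (funext fun i => ?_)
    obtain ⟨k, rfl | rfl⟩ : ∃ k, i = 2 * k ∨ i = 2 * k + 1 := ⟨i / 2, by omega⟩
    · rw [← count_conjugateHalves_fst, h, count_conjugateHalves_fst]
    · rw [← count_conjugateHalves_snd, h, count_conjugateHalves_snd]
  · rintro ⟨M, N⟩
    have hb : ∀ s : Multiset ℕ+, ∃ n : ℕ, ∀ k, n ≤ k → s.count k.succPNat = 0 := fun s => by
      -- An element k + 1 of `s` cannot exceed the sum of `s`.
      refine ⟨(s.map PNat.val).sum, fun k hk => Multiset.count_eq_zero.2 fun hs => ?_⟩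
      have := Multiset.le_sum_of_mem (Multiset.mem_map_of_mem PNat.val hs)
      rw [Nat.succPNat_coe] at this
      omega
    obtain ⟨m, hm⟩ := hb M
    obtain ⟨n, hn⟩ := hb N
    obtain ⟨p, hp⟩ := exists_partDiff_eq (N := 2 * (m + n))
      (d := fun i => if i % 2 = 0 then M.count (i / 2).succPNat else N.count (i / 2).succPNat)
      fun i hi => by
        rw [hm _ (by omega), hn _ (by omega), ite_self]
    refine ⟨p, Prod.ext (Multiset.ext.2 fun a => ?_) (Multiset.ext.2 fun a => ?_)⟩
    · rw [← PNat.succPNat_natPred a, count_conjugateHalves_fst, hp]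
      simp
    · rw [← PNat.succPNat_natPred a, count_conjugateHalves_snd, hp]
      have h1 : (2 * a.natPred + 1) % 2 = 1 := by omega
      have h2 : (2 * a.natPred + 1) / 2 = a.natPred := by omega
      simp [h1, h2]

/-! ### Finiteness in bounded weight -/

theorem size_le_two_mul_schmidtWeight (p : AnyPartition) : p.size ≤ 2 * p.schmidtWeight := by
  obtain ⟨h1, h2⟩ := List.sum_getD_two_mul _ _ p.length_sortedParts.le
  have hsum : ∀ l : List ℕ, l.sum = l.alternateSums.1 + l.alternateSums.2 := fun l => by
    induction l with
    | nil => rfl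
    | cons a l ih => rw [List.sum_cons, ih, List.alternateSums_cons]; dsimp only; omega
  have hle : p.sortedParts.alternateSums.2 ≤ p.sortedParts.alternateSums.1 := by
    rw [← h1, ← h2]
    exact Finset.sum_le_sum fun k _ => p.part_antitone (Nat.le_succ (2 * k))
  have hs : p.size = p.sortedParts.sum := by
    rw [size, ← Multiset.sum_coe, sortedParts, Multiset.sort_eq]
  rw [schmidtWeight_eq_alternateSums, hs, hsum]
  omega

theorem finite_size_le (n : ℕ) : {p : AnyPartition | p.size ≤ n}.Finite := by
  have : {p : AnyPartition | p.size ≤ n} ⊆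
      ((Finset.range (n + 1)).sigma fun _ => Finset.univ : Finset AnyPartition) := by
    rintro ⟨m, p⟩ h
    have h : p.parts.sum ≤ n := h
    rw [p.parts_sum] at h
    simpa using Nat.lt_succ_of_le h
  exact (Finset.finite_toSet _).subset this

theorem finite_size_ofParts_le (n : ℕ) : {s : Multiset ℕ+ | (ofParts s).size ≤ n}.Finite :=
  (finite_size_le n).preimage ofParts_bijective.1.injOn

end AnyPartition

theorem Prod.finite_add_le {α β : Type*} {v : α → ℕ} {w : β → ℕ}
    (hv : ∀ n, {a | v a ≤ n}.Finite) (hw : ∀ n, {b | w b ≤ n}.Finite) (n : ℕ) :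
    {x : α × β | v x.1 + w x.2 ≤ n}.Finite :=
  ((hv n).prod (hw n)).subset fun x hx => by
    have hx : v x.1 + w x.2 ≤ n := hx
    exact ⟨show v x.1 ≤ n by omega, show w x.2 ≤ n by omega⟩

/-! ### Sums of power series graded by one variable -/

namespace MvPowerSeries

variable {σ R : Type*} [CommRing R] [TopologicalSpace R]

/-- Only indices with `w i ≤ d s` contribute to the coefficient at `d`, whatever the factors `f i`
are. -/
theorem summable_mul_X_pow {ι : Type*} {w : ι → ℕ} (hw : ∀ n, {i | w i ≤ n}.Finite)
    (f : ι → MvPowerSeries σ R) (s : σ) : Summable fun i => f i * X s ^ w i := by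
  refine WithPiTopology.summable_iff_summable_coeff.2 fun d =>
    summable_of_hasFiniteSupport ((hw (d s)).subset fun i hi => ?_)
  by_contra! h
  exact hi (X_pow_dvd_iff.1 (Dvd.intro_left _ rfl) d (not_le.1 h))

theorem tsum_mul_tsum_mul_X_pow [T3Space R] [IsTopologicalRing R] {α β : Type*}
    {v : α → ℕ} {w : β → ℕ} (hv : ∀ n, {a | v a ≤ n}.Finite) (hw : ∀ n, {b | w b ≤ n}.Finite)
    (f : α → MvPowerSeries σ R) (g : β → MvPowerSeries σ R) (s : σ) :
    (∑' a, f a * X s ^ v a) * ∑' b, g b * X s ^ w b =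
      ∑' x : α × β, f x.1 * g x.2 * X s ^ (v x.1 + w x.2) := by
  have hfg : ∀ x : α × β, f x.1 * X s ^ v x.1 * (g x.2 * X s ^ w x.2) =
      f x.1 * g x.2 * X s ^ (v x.1 + w x.2) := fun x => by ring
  have : T3Space (MvPowerSeries σ R) := inferInstanceAs (T3Space ((σ →₀ ℕ) → R))
  rw [(summable_mul_X_pow hv f s).tsum_mul_tsum (summable_mul_X_pow hw g s)]
  · exact tsum_congr hfg
  · exact (summable_congr hfg).2 (summable_mul_X_pow (Prod.finite_add_le hv hw) _ s)

/-- The constant term is 1, coming from `i₀` alone. The factor `1 *` matches the shape of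
`tsum_mul_tsum_mul_X_pow`. -/
theorem isUnit_tsum_X_pow [T2Space R] {ι : Type*} {w : ι → ℕ} (hw : ∀ n, {i | w i ≤ n}.Finite)
    {i₀ : ι} (h₀ : ∀ i, w i = 0 ↔ i = i₀) (s : σ) :
    IsUnit (∑' i, 1 * X s ^ w i : MvPowerSeries σ R) := by
  have h := WithPiTopology.hasSum_iff_hasSum_coeff.1
    (summable_mul_X_pow hw (fun _ => (1 : MvPowerSeries σ R)) s).hasSum 0
  rw [isUnit_iff_constantCoeff, ← coeff_zero_eq_constantCoeff_apply, ← h.tsum_eq,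
    tsum_eq_single i₀]
  · simp [(h₀ i₀).2 rfl]
  · intro i hi
    have : w i ≠ 0 := fun h => hi ((h₀ i).1 h)
    simp [coeff_zero_eq_constantCoeff_apply, this]

end MvPowerSeries

/-! ### Schmidt's theorem by cancelling a unit -/

namespace AnyPartition

theorem finite_schmidtWeight_le (n : ℕ) : {p : AnyPartition | p.schmidtWeight ≤ n}.Finite :=
  (finite_size_le (2 * n)).subset fun p hp =>
    p.size_le_two_mul_schmidtWeight.trans (Nat.mul_le_mul_left 2 hp)

theorem finite_schmidtWeight_ofParts_val_le (n : ℕ) :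
    {A : Finset ℕ+ | (ofParts A.val).schmidtWeight ≤ n}.Finite :=
  (finite_schmidtWeight_le n).preimage
    (ofParts_bijective.1.comp Finset.val_injective).injOn

theorem finite_size_ofParts_val_le (n : ℕ) :
    {A : Finset ℕ+ | (ofParts A.val).size ≤ n}.Finite :=
  (finite_size_ofParts_le n).preimage Finset.val_injective.injOn

theorem size_ofParts_eq_zero (s : Multiset ℕ+) : (ofParts s).size = 0 ↔ s = 0 := by
  rw [size_ofParts, Multiset.sum_eq_zero_iff]
  refine ⟨fun h => Multiset.eq_zero_of_forall_notMem fun a ha => ?_, by rintro rfl; simp⟩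
  exact a.pos.ne' (h _ (Multiset.mem_map_of_mem _ ha))

open MvPowerSeries in
/-- Schmidt's theorem on partitions into distinct parts, refined by the alternating sum. -/
theorem tsum_distinct_eq_tsum {σ R : Type*} [CommRing R] [TopologicalSpace R]
    [T3Space R] [IsTopologicalRing R] (t : MvPowerSeries σ R) (s : σ) :
    ∑' A : Finset ℕ+, t ^ (ofParts A.val).alternatingSum * X s ^ (ofParts A.val).schmidtWeight =
      ∑' M : Multiset ℕ+, t ^ M.card * X s ^ (ofParts M).size := by
  refine (isUnit_tsum_X_pow finite_size_ofParts_le size_ofParts_eq_zero s).mul_left_injective ?_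
  dsimp only
  rw [tsum_mul_tsum_mul_X_pow finite_schmidtWeight_ofParts_val_le finite_size_ofParts_le,
    tsum_mul_tsum_mul_X_pow finite_size_ofParts_le finite_size_ofParts_le]
  -- Both products are this sum over all partitions: by p = A + 2N on one side, by conjugation on
  -- the other.
  trans ∑' p : AnyPartition, t ^ p.alternatingSum * X s ^ p.schmidtWeight
  · rw [← (Equiv.ofBijective _
      (ofParts_bijective.comp Multiset.finset_add_two_nsmul_bijective)).tsum_eq]
    refine tsum_congr fun x => ?_
    simp only [Equiv.ofBijective_apply, Function.comp_apply, alternatingSum_ofParts_add,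
      schmidtWeight_ofParts_add, mul_one]
  · rw [← (Equiv.ofBijective _ conjugateHalves_bijective).tsum_eq]
    refine tsum_congr fun p => ?_
    simp only [Equiv.ofBijective_apply, card_conjugateHalves_fst, size_conjugateHalves, mul_one]

end AnyPartition

/-! ### Factoring both sides -/

theorem corollary7 (R : Type*) [CommRing R] [TopologicalSpace R] [DiscreteTopology R]
    (t₁ t₂ q : MvPowerSeries (Fin 3) R)
    (ht₁ : t₁ = MvPowerSeries.X 0) (ht₂ : t₂ = MvPowerSeries.X 1) (hq : q = MvPowerSeries.X 2) :
    Summable (fun p : PartitionsRepeatedLT 4 =>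
      t₁ ^ p.1.repeatedSizes * t₂ ^ p.1.alternatingSum * q ^ p.1.schmidtWeight) ∧
    Summable (fun μ : Overpartition =>
      t₁ ^ μ.numOverlined * t₂ ^ (μ.length - μ.numOverlined) * q ^ μ.size) ∧
    ∑' p : PartitionsRepeatedLT 4,
      t₁ ^ p.1.repeatedSizes * t₂ ^ p.1.alternatingSum * q ^ p.1.schmidtWeight =
    ∑' μ : Overpartition,
      t₁ ^ μ.numOverlined * t₂ ^ (μ.length - μ.numOverlined) * q ^ μ.size := by
  subst hq
  have hL : ∀ x : Finset ℕ+ × Finset ℕ+,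
      t₁ ^ (PartitionsRepeatedLT.ofFinsets x).1.repeatedSizes *
        t₂ ^ (PartitionsRepeatedLT.ofFinsets x).1.alternatingSum *
        MvPowerSeries.X 2 ^ (PartitionsRepeatedLT.ofFinsets x).1.schmidtWeight =
      t₂ ^ (AnyPartition.ofParts x.1.val).alternatingSum * t₁ ^ x.2.card *
        MvPowerSeries.X 2 ^ ((AnyPartition.ofParts x.1.val).schmidtWeight +
          (AnyPartition.ofParts x.2.val).size) := fun x => by
    rw [PartitionsRepeatedLT.ofFinsets, AnyPartition.repeatedSizes_ofParts_add,
      AnyPartition.alternatingSum_ofParts_add, AnyPartition.schmidtWeight_ofParts_add,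
      mul_comm (t₁ ^ _)]
  have hR : ∀ x : Finset ℕ+ × Multiset ℕ+,
      t₁ ^ (Overpartition.ofParts x).numOverlined *
        t₂ ^ ((Overpartition.ofParts x).length - (Overpartition.ofParts x).numOverlined) *
        MvPowerSeries.X 2 ^ (Overpartition.ofParts x).size =
      t₁ ^ x.1.card * t₂ ^ x.2.card *
        MvPowerSeries.X 2 ^ ((AnyPartition.ofParts x.1.val).size +
          (AnyPartition.ofParts x.2).size) := fun x => by
    rw [Overpartition.length_ofParts, Overpartition.numOverlined_ofParts,
      Overpartition.size_ofParts, add_tsub_cancel_left]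
  let eL := Equiv.ofBijective _ PartitionsRepeatedLT.ofFinsets_bijective
  let eR := Equiv.ofBijective _ Overpartition.ofParts_bijective
  refine ⟨eL.summable_iff.1 ((summable_congr hL).2 ?_),
    eR.summable_iff.1 ((summable_congr hR).2 ?_), ?_⟩
  · exact MvPowerSeries.summable_mul_X_pow (Prod.finite_add_le
      AnyPartition.finite_schmidtWeight_ofParts_val_le AnyPartition.finite_size_ofParts_val_le) _ _
  · exact MvPowerSeries.summable_mul_X_pow (Prod.finite_add_le
      AnyPartition.finite_size_ofParts_val_le AnyPartition.finite_size_ofParts_le) _ _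
  · rw [← eL.tsum_eq, ← eR.tsum_eq]
    refine (tsum_congr hL).trans (Eq.trans ?_ (tsum_congr hR).symm)
    rw [← MvPowerSeries.tsum_mul_tsum_mul_X_pow AnyPartition.finite_schmidtWeight_ofParts_val_le
        AnyPartition.finite_size_ofParts_val_le
        (fun A => t₂ ^ (AnyPartition.ofParts A.val).alternatingSum) (fun B => t₁ ^ B.card),
      ← MvPowerSeries.tsum_mul_tsum_mul_X_pow AnyPartition.finite_size_ofParts_val_le
        AnyPartition.finite_size_ofParts_le (fun A => t₁ ^ A.card) (fun M => t₂ ^ M.card),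
      AnyPartition.tsum_distinct_eq_tsum, mul_comm]
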